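/- Let $\{0,1\}^*$ be the set of finite binary strings. A prefix machine is a partial computable function $M(p\mid y)$ of a program $p\in\{0,1\}^*$ and a condition $y\in\{0,1\}^*$, with values in $\{0,1\}^*$, such that for every fixed $y$ the set of programs $p$ for which $M(p\mid y)$ is defined is prefix-free. A prefix machine $U$ is called universal if for every prefix machine $M$ there is a constant $c_M$ such that whenever $M(p\mid y)=x$ there is a $q$ with $U(q\mid y)=x$ and $|q|\le |p|+c_M$. For such a $U$ let $$K(x\mid y)=\min\{|p| : U(p\mid y)=x\},\qquad E(x,y)=\max\{K(x\mid y),K(y\mid x)\}.$$ A function $D:\{0,1\}^*\times\{0,1\}^*\to[0,\infty)$ is an admissible distance if it is symmetric, upper semicomputable (the set of $(x,y,q)$ with $q\in\mathbb{Q}_{\ge 0}$ and $D(x,y)<q$ is recursively enumerable) and satisfies the density condition $\sum_{y}2^{-D(x,y)}\le 1$ for every $x$. It is admissible in the wider sense if the density condition is only required in the form $\sum_{y\ne x}2^{-D(x,y)}\le 1$ for every $x$. Theorem. Universal prefix machines exist, and for every universal prefix machine $U$ the following hold. (0) For all $x,y$ there is a $p$ with $U(p\mid y)=x$, so that $K(x\mid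 y)$ and $E(x,y)$ are well defined. (1) $E$ is an admissible distance; in particular $\sum_y 2^{-E(x,y)}\le 1$ for every $x$, the term $y=x$ included. (2) $E$ is a metric up to an additive constant: there is a constant $c\in\mathbb{N}$ such that for all $x,y,z$: $E(x,y)\ge 0$, $E(x,x)\le c$, $E(x,y)=0$ only if $x=y$, $E(x,y)=E(y,x)$, and $E(x,y)\le E(x,z)+E(z,y)+c$. Moreover $c$ can be chosen such that, in addition, the function equal to $E(x,y)+c$ for $x\neq y$ and to $0$ for $x=y$ is a metric in the exact sense and is admissible in the wider sense. (3) $E$ is minimal: for every $D$ that is admissible in the wider sense (in particular for every admissible distance $D$) there is a constant $c_D$ such that $E(x,y)\le D(x,y)+c_D$ for all $x,y$. -/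

import Mathlib

open scoped ENNReal

namespace InfoDist

/-- The objects and the programs: finite binary strings. -/
abbrev BStr : Type := List Bool

/-- A (conditional) prefix machine: a partial computable function `M p y` of a program `p` and a
condition `y` such that, for every fixed condition, the set of halting programs is prefix-free. -/
structure IsPrefixMachine (M : BStr → BStr →. BStr) : Prop where
  partrec : Partrec₂ M
  prefix_free : ∀ y p q : BStr, (M p y).Dom → (M q y).Dom → p <+: q → p = q

/-- A universal prefix machine: a prefix machine that produces every conditional output of any
other prefix machine with programs that are longer by at most a constant. -/
structure IsUniversalPrefixMachine (U : BStr → BStr →. BStr) : Prop where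
  isPrefixMachine : IsPrefixMachine U
  optimal : ∀ M : BStr → BStr →. BStr, IsPrefixMachine M →
    ∃ c : ℕ, ∀ p y x : BStr, x ∈ M p y → ∃ q : BStr, x ∈ U q y ∧ q.length ≤ p.length + c

/-- Conditional Kolmogorov complexity `K(x | y) = min {|p| : U(p | y) = x}`. -/
noncomputable def K (U : BStr → BStr →. BStr) (x y : BStr) : ℕ :=
  sInf {n : ℕ | ∃ p : BStr, x ∈ U p y ∧ p.length = n}

/-- Information distance `E(x, y) = max {K(x | y), K(y | x)}`. -/
noncomputable def E (U : BStr → BStr →. BStr) (x y : BStr) : ℝ :=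
  ((max (K U x y) (K U y x) : ℕ) : ℝ)

/-- Upper semicomputability of a nonnegative function: the set of all `(x, y, q)` with `q` a
nonnegative rational and `D x y < q` is recursively enumerable; `q` is given as `a / (b + 1)`. -/
def UpperSemicomputable (D : BStr → BStr → ℝ) : Prop :=
  REPred fun t : (BStr × BStr) × (ℕ × ℕ) => D t.1.1 t.1.2 < (t.2.1 : ℝ) / ((t.2.2 : ℝ) + 1)

/-- Admissible distance, with the density condition `∑_y 2 ^ (-D(x, y)) ≤ 1` over all `y`. -/
structure IsAdmissible (D : BStr → BStr → ℝ) : Prop where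
  nonneg : ∀ x y, 0 ≤ D x y
  symm : ∀ x y, D x y = D y x
  upperSemicomputable : UpperSemicomputable D
  density : ∀ x, ∑' y : BStr, ENNReal.ofReal ((2 : ℝ) ^ (-D x y)) ≤ 1

/-- Admissible distance in the wider sense: the density condition is over the `y ≠ x` only, so
that functions vanishing on the diagonal, such as metrics, are not excluded. -/
structure IsOffDiagAdmissible (D : BStr → BStr → ℝ) : Prop where
  nonneg : ∀ x y, 0 ≤ D x y
  symm : ∀ x y, D x y = D y x
  upperSemicomputable : UpperSemicomputable D
  density : ∀ x, ∑' y : {y : BStr // y ≠ x}, ENNReal.ofReal ((2 : ℝ) ^ (-D x y)) ≤ 1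

theorem IsAdmissible.isOffDiagAdmissible {D : BStr → BStr → ℝ} (h : IsAdmissible D) :
    IsOffDiagAdmissible D where
  nonneg := h.nonneg
  symm := h.symm
  upperSemicomputable := h.upperSemicomputable
  density x := (ENNReal.tsum_comp_le_tsum_of_injective Subtype.val_injective
    (fun y : BStr => ENNReal.ofReal ((2 : ℝ) ^ (-D x y)))).trans (h.density x)

/-- The metric axioms. -/
structure IsMetric (D : BStr → BStr → ℝ) : Prop where
  nonneg : ∀ x y, 0 ≤ D x y
  eq_zero_iff : ∀ x y, D x y = 0 ↔ x = y
  symm : ∀ x y, D x y = D y x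
  triangle : ∀ x y z, D x y ≤ D x z + D z y

/-- The metric axioms up to the additive constant `c`. Positivity and symmetry are exact;
`D(x, x) = 0` and the triangle inequality hold up to `c`. -/
structure IsMetricUpTo (c : ℝ) (D : BStr → BStr → ℝ) : Prop where
  nonneg : ∀ x y, 0 ≤ D x y
  self_le : ∀ x, D x x ≤ c
  eq_of_eq_zero : ∀ x y, D x y = 0 → x = y
  symm : ∀ x y, D x y = D y x
  triangle : ∀ x y z, D x y ≤ D x z + D z y + c

/-- `D` shifted by `c` off the diagonal and set to `0` on the diagonal. -/
noncomputable def shift (c : ℝ) (D : BStr → BStr → ℝ) (x y : BStr) : ℝ :=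
  if x = y then 0 else D x y + c

end InfoDist

/-! Everything about a universal `U` is obtained by exhibiting a suitable prefix machine `M` and
paying the constant that optimality charges for `M`. The lower bounds on lengths come from the Kraft
inequality.

Existence of `U`: any code can be pruned to a prefix-free domain by letting a program speak only if
it is the first among the programs comparable with it to be seen halting (`prefixFreed`). Genuine
prefix machines are unchanged by this, so one may enumerate all codes and put the index in unary
before the program.

Density holds because shortest programs under a fixed condition form a prefix-free set, so
Kraft–McMillan bounds `∑ 2 ^ (-K(y | x))`, and `E(x, y) ≥ K(y | x)`. The triangle inequality holds
because self-delimiting programs can be concatenated and run in sequence (`exists_compMachine`).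

Minimality is the deep half. For fixed `y`, the facts `D y x < n` are enumerable, and each is turned
into one request to give `x` a codeword of length about `n`. The density condition bounds the total
weight of the requests by `1`, so the Kraft–Chaitin allocation (`exists_machine_of_requests`) serves
them online and `K(x | y) ≤ D y x + O(1)`. Symmetry of `D` gives the other half of the maximum. -/

namespace InfoDist

open Encodable
open Nat.Partrec (Code)

/-! ### Stagewise evaluation of partial computable functions -/

section Stage

variable {α β : Type*} [Primcodable α] [Primcodable β]

/-- The value at `a`, if found within `k` steps, of the partial function `α →. β` with code `c`. -/
def stage (β : Type*) [Primcodable β] (c : Code) (k : ℕ) (a : α) : Option β :=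
  (Code.evaln k c (encode a)).bind decode

theorem stage_mono {c : Code} {k m : ℕ} (h : k ≤ m) {a : α} {b : β}
    (hb : b ∈ stage β c k a) : b ∈ stage β c m a := by
  simp only [stage, Option.mem_def, Option.bind_eq_some_iff] at hb ⊢
  obtain ⟨n, hn, hd⟩ := hb
  exact ⟨n, Code.evaln_mono h hn, hd⟩

/-- Replaces a partial computable function by monotone primitive recursive approximations, so that
every later construction is one unbounded search over a primitive recursive test. -/
theorem exists_stage {f : α →. β} (hf : Partrec f) :
    ∃ c : Code, ∀ a b, b ∈ f a ↔ ∃ k, b ∈ stage β c k a := by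
  obtain ⟨c, hc⟩ := Code.exists_code.1 hf
  refine ⟨c, fun a b => ?_⟩
  have key : Code.eval c (encode a) = (f a).map encode := by simp [hc]
  constructor
  · intro hb
    obtain ⟨k, hk⟩ := Code.evaln_complete.1 (key ▸ Part.mem_map encode hb)
    exact ⟨k, by simp [stage, Option.mem_def.1 hk]⟩
  · rintro ⟨k, hk⟩
    simp only [stage, Option.mem_def, Option.bind_eq_some_iff] at hk
    obtain ⟨n, hn, hd⟩ := hk
    have := Code.evaln_sound hn
    rw [key, Part.mem_map_iff] at this
    obtain ⟨b', hb', rfl⟩ := this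
    simp only [encodek, Option.some.injEq] at hd
    exact hd ▸ hb'

theorem primrec_stage :
    Primrec fun t : (ℕ × Code) × α => stage β t.1.2 t.1.1 t.2 :=
  Primrec.option_bind
    (Code.primrec_evaln.comp (Primrec.fst.pair (Primrec.encode.comp Primrec.snd)))
    (Primrec.decode.comp Primrec.snd).to₂

theorem exists_evaln_of_rePred {p : α → Prop} (hp : REPred p) :
    ∃ c : Code, ∀ a, p a ↔ ∃ k, (Code.evaln k c (encode a)).isSome := by
  obtain ⟨c, hc⟩ := Code.exists_code.1 hp
  refine ⟨c, fun a => ?_⟩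
  have key : (Code.eval c (encode a)).Dom ↔ p a := by simp [hc, Part.assert]
  rw [← key, Part.dom_iff_mem]
  simp only [Code.evaln_complete, Option.isSome_iff_exists, Option.mem_def]
  exact exists_comm

theorem rePred_of_exists {p : α → Prop} {r : α → ℕ → Bool} (hr : Computable₂ r)
    (h : ∀ a, p a ↔ ∃ n, r a n = true) : REPred p := by
  have : Partrec fun a => Nat.rfind fun n => Part.some (r a n) := Partrec.rfind hr.partrec₂
  refine this.dom_re.of_eq fun a => ⟨fun hd => (h a).2 ?_, fun ha => ?_⟩
  · exact ⟨_, (Part.mem_some_iff.1 (Nat.rfind_spec (Part.get_mem hd))).symm⟩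
  · obtain ⟨n, hn⟩ := (h a).1 ha
    obtain ⟨m, hm, -⟩ := Nat.rfind_min' (p := r a) hn
    exact Part.dom_iff_mem.2 ⟨m, hm⟩

end Stage

/-! ### Prefix machines -/

/-- A partial function obtained by unbounded search through a computable sequence of options. -/
def searchMachine (h : BStr × BStr → ℕ → Option BStr) (p y : BStr) : Part BStr :=
  Nat.rfindOpt (h (p, y))

theorem searchMachine_partrec {h : BStr × BStr → ℕ → Option BStr} (hh : Computable₂ h) :
    Partrec₂ (searchMachine h : BStr → BStr →. BStr) :=
  Partrec.rfindOpt hh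

theorem searchMachine_sound {h : BStr × BStr → ℕ → Option BStr} {p y x : BStr}
    (hx : x ∈ searchMachine h p y) : ∃ s, x ∈ h (p, y) s :=
  Nat.rfindOpt_spec hx

theorem searchMachine_dom {h : BStr × BStr → ℕ → Option BStr} {p y : BStr} :
    (searchMachine h p y).Dom ↔ ∃ s x, x ∈ h (p, y) s :=
  Nat.rfindOpt_dom

/-- The search returns its first hit, which need not be the one at `s`; hence the requirement that
all hits agree. -/
theorem mem_searchMachine {h : BStr × BStr → ℕ → Option BStr} {p y x : BStr} {s : ℕ}
    (hs : x ∈ h (p, y) s) (huniq : ∀ t x', x' ∈ h (p, y) t → x' = x) :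
    x ∈ searchMachine h p y := by
  have hd : (searchMachine h p y).Dom := searchMachine_dom.2 ⟨s, x, hs⟩
  obtain ⟨t, ht⟩ := searchMachine_sound (Part.get_mem hd)
  exact huniq t _ ht ▸ Part.get_mem hd

theorem IsPrefixMachine.eq_of_prefix {M : BStr → BStr →. BStr} (hM : IsPrefixMachine M)
    {p q x x' y : BStr} (hp : x ∈ M p y) (hq : x' ∈ M q y) (h : p <+: q) : p = q ∧ x = x' := by
  have hpq : p = q := hM.prefix_free y p q (Part.dom_iff_mem.2 ⟨_, hp⟩)
    (Part.dom_iff_mem.2 ⟨_, hq⟩) h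
  subst hpq
  exact ⟨rfl, Part.mem_unique hp hq⟩

/-- The prefix machine whose only program is the empty one, with output `f y`. -/
theorem isPrefixMachine_nil {f : BStr → BStr} (hf : Primrec f) :
    IsPrefixMachine (searchMachine fun t _ => if t.1 = [] then some (f t.2) else none) where
  partrec := searchMachine_partrec <| Primrec.to_comp <| Primrec.ite
    (Primrec.eq.comp (Primrec.fst.comp Primrec.fst) (Primrec.const []))
    (Primrec.option_some.comp (hf.comp (Primrec.snd.comp Primrec.fst))) (Primrec.const none)
  prefix_free y p q hp hq _ := by
    simp only [searchMachine_dom] at hp hq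
    obtain ⟨_, _, hp⟩ := hp
    obtain ⟨_, _, hq⟩ := hq
    have hp' : p = [] := by by_contra h; simp [h] at hp
    have hq' : q = [] := by by_contra h; simp [h] at hq
    rw [hp', hq']

theorem mem_nilMachine (f : BStr → BStr) (y : BStr) :
    f y ∈ searchMachine (fun t _ => if t.1 = [] then some (f t.2) else none) [] y :=
  mem_searchMachine (s := 0) (by simp) (by simp)

/-- Sequential composition of a machine with itself: a program for `z` given `y` followed by a
program for `x` given `z` is a program for `x` given `y`. -/
theorem exists_compMachine {U : BStr → BStr →. BStr} (hU : IsPrefixMachine U) :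
    ∃ M : BStr → BStr →. BStr, IsPrefixMachine M ∧
      ∀ p q x y z, z ∈ U p y → x ∈ U q z → x ∈ M (p ++ q) y := by
  obtain ⟨c, hc⟩ := exists_stage (α := BStr × BStr) (β := BStr) hU.partrec
  have hc' : ∀ p y x, x ∈ U p y ↔ ∃ k, x ∈ stage BStr c k (p, y) := fun p y x => hc (p, y) x
  let h : BStr × BStr → ℕ → Option BStr := fun t s =>
    (decode (α := (BStr × BStr) × ℕ) s).bind fun e =>
      if e.1.1 ++ e.1.2 = t.1 then
        (stage BStr c e.2 (e.1.1, t.2)).bind fun z => stage BStr c e.2 (e.1.2, z)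
      else none
  have hcomp : Computable₂ h := by
    refine Primrec.to_comp (f := fun t : (BStr × BStr) × ℕ => h t.1 t.2) ?_
    refine Primrec.option_bind (Primrec.decode.comp Primrec.snd) ?_
    refine Primrec.ite ?_ ?_ (Primrec.const none)
    · exact Primrec.eq.comp
        (Primrec.list_append.comp (Primrec.fst.comp (Primrec.fst.comp Primrec.snd))
          (Primrec.snd.comp (Primrec.fst.comp Primrec.snd)))
        (Primrec.fst.comp (Primrec.fst.comp Primrec.fst))
    · refine Primrec.option_bind ?_ ?_
      · exact primrec_stage.comp (((Primrec.snd.comp Primrec.snd).pair (Primrec.const c)).pair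
          ((Primrec.fst.comp (Primrec.fst.comp Primrec.snd)).pair
            (Primrec.snd.comp (Primrec.fst.comp Primrec.fst))))
      · exact primrec_stage.comp
          (((Primrec.snd.comp (Primrec.snd.comp Primrec.fst)).pair (Primrec.const c)).pair
          ((Primrec.snd.comp (Primrec.fst.comp (Primrec.snd.comp Primrec.fst))).pair
            Primrec.snd))
  have sound : ∀ r y s x, x ∈ h (r, y) s →
      ∃ p q z, p ++ q = r ∧ z ∈ U p y ∧ x ∈ U q z := by
    intro r y s x hx
    simp only [h, Option.mem_def, Option.bind_eq_some_iff, Option.ite_none_right_eq_some] at hx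
    obtain ⟨e, -, he, z, hz, hx⟩ := hx
    exact ⟨e.1.1, e.1.2, z, he, (hc' _ _ _).2 ⟨_, hz⟩, (hc' _ _ _).2 ⟨_, hx⟩⟩
  have pf : ∀ p q z x p' q' z' x' y, z ∈ U p y → x ∈ U q z → z' ∈ U p' y → x' ∈ U q' z' →
      p ++ q <+: p' ++ q' → p ++ q = p' ++ q' ∧ x = x' := by
    intro p q z x p' q' z' x' y hz hx hz' hx' hpre
    -- Both first halves are prefixes of one string, hence comparable; prefix-freeness under `y`
    -- identifies them, so the second halves run under the same condition `z`.
    have hpp : p = p' ∧ z = z' := by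
      rcases List.prefix_or_prefix_of_prefix ((List.prefix_append p q).trans hpre)
        (List.prefix_append p' q') with h | h
      · exact hU.eq_of_prefix hz hz' h
      · exact (hU.eq_of_prefix hz' hz h).imp Eq.symm Eq.symm
    obtain ⟨rfl, rfl⟩ := hpp
    obtain ⟨rfl, rfl⟩ := hU.eq_of_prefix hx hx' ((List.prefix_append_right_inj p).1 hpre)
    exact ⟨rfl, rfl⟩
  refine ⟨searchMachine h, ⟨searchMachine_partrec hcomp, ?_⟩, ?_⟩
  · intro y r r' hr hr' hpre
    obtain ⟨s, x, hx⟩ := searchMachine_dom.1 hr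
    obtain ⟨s', x', hx'⟩ := searchMachine_dom.1 hr'
    obtain ⟨p, q, z, rfl, hz, hxq⟩ := sound _ _ _ _ hx
    obtain ⟨p', q', z', rfl, hz', hxq'⟩ := sound _ _ _ _ hx'
    exact (pf _ _ _ _ _ _ _ _ _ hz hxq hz' hxq' hpre).1
  · intro p q x y z hz hx
    obtain ⟨k, hk⟩ := (hc' _ _ _).1 hz
    obtain ⟨m, hm⟩ := (hc' _ _ _).1 hx
    refine mem_searchMachine (s := encode ((p, q), max k m)) ?_ ?_
    · simp only [h, encodek, Option.mem_def, Option.bind_some, if_true]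
      rw [Option.mem_def.1 (stage_mono (le_max_left k m) hk)]
      exact stage_mono (le_max_right k m) hm
    · intro t x' hx'
      obtain ⟨p', q', z', he, hz', hxq'⟩ := sound _ _ _ _ hx'
      exact (pf _ _ _ _ _ _ _ _ _ hz' hxq' hz hx (he ▸ List.prefix_refl _)).2

/-! ### Existence of a universal prefix machine -/

/-- Search for the first computation of the code `c` with condition `y` that halts on a program
comparable with `p`: the search ends with the output if that program is `p` and with `none`
otherwise. -/
def prefixStep (c : Code) (p y : BStr) (s : ℕ) : Option (Option BStr) :=
  (decode (α := BStr × ℕ) s).bind fun e =>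
    (stage BStr c e.2 (e.1, y)).bind fun x =>
      if e.1 = p.take e.1.length ∨ p = e.1.take p.length then
        some (if e.1 = p then some x else none)
      else none

theorem primrec_prefixStep :
    Primrec fun t : ((Code × BStr) × BStr) × ℕ => prefixStep t.1.1.1 t.1.1.2 t.1.2 t.2 := by
  refine Primrec.option_bind (Primrec.decode.comp Primrec.snd) ?_
  refine Primrec.option_bind ?_ ?_
  · exact primrec_stage.comp (((Primrec.snd.comp Primrec.snd).pair
      (Primrec.fst.comp (Primrec.fst.comp (Primrec.fst.comp Primrec.fst)))).pair
      ((Primrec.fst.comp Primrec.snd).pair (Primrec.snd.comp (Primrec.fst.comp Primrec.fst))))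
  · have he : Primrec fun t : ((((Code × BStr) × BStr) × ℕ) × (BStr × ℕ)) × BStr => t.1.2.1 :=
      Primrec.fst.comp (Primrec.snd.comp Primrec.fst)
    have hp : Primrec fun t : ((((Code × BStr) × BStr) × ℕ) × (BStr × ℕ)) × BStr =>
        t.1.1.1.1.2 :=
      Primrec.snd.comp (Primrec.fst.comp (Primrec.fst.comp (Primrec.fst.comp Primrec.fst)))
    refine Primrec.ite (PrimrecPred.or ?_ ?_) (Primrec.option_some.comp (Primrec.ite ?_ ?_ ?_))
      (Primrec.const none)
    · exact Primrec.eq.comp he (Primrec.list_take.comp (Primrec.list_length.comp he) hp)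
    · exact Primrec.eq.comp hp (Primrec.list_take.comp (Primrec.list_length.comp hp) he)
    · exact Primrec.eq.comp he hp
    · exact Primrec.option_some.comp Primrec.snd
    · exact Primrec.const none

theorem mem_prefixStep {c : Code} {p y : BStr} {s : ℕ} {o : Option BStr} :
    o ∈ prefixStep c p y s ↔ ∃ q k x, decode s = some (q, k) ∧ x ∈ stage BStr c k (q, y) ∧
      (q <+: p ∨ p <+: q) ∧ o = if q = p then some x else none := by
  simp only [prefixStep, Option.mem_def, Option.bind_eq_some_iff,
    Option.ite_none_right_eq_some, Prod.exists, ← List.prefix_iff_eq_take, Option.some.injEq,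
    eq_comm (a := o)]
  constructor
  · rintro ⟨q, k, h1, x, h2, h3, h4⟩
    exact ⟨q, k, x, h1, h2, h3, h4⟩
  · rintro ⟨q, k, x, h1, h2, h3, h4⟩
    exact ⟨q, k, h1, x, h2, h3, h4⟩

/-- The partial function with code `c`, restricted to a prefix-free set of programs. -/
def prefixFreed (c : Code) (p y : BStr) : Part BStr :=
  (Nat.rfind fun s => Part.some (prefixStep c p y s).isSome).bind fun s =>
    ((prefixStep c p y s).bind id : Option BStr)

theorem partrec_prefixFreed :
    Partrec fun t : (Code × BStr) × BStr => prefixFreed t.1.1 t.1.2 t.2 :=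
  Partrec.bind
    (Partrec.rfind (Primrec.option_isSome.comp primrec_prefixStep).to_comp.partrec)
    (Primrec.option_bind primrec_prefixStep Primrec.snd.to₂).to_comp.ofOption

theorem mem_prefixFreed {c : Code} {p y x : BStr} :
    x ∈ prefixFreed c p y ↔ ∃ s, some x ∈ prefixStep c p y s ∧
      ∀ m < s, prefixStep c p y m = none := by
  simp only [prefixFreed, Part.mem_bind_iff]
  refine exists_congr fun s => ⟨?_, ?_⟩
  · rintro ⟨hs, hx⟩
    obtain ⟨o, ho, rfl⟩ := Option.bind_eq_some_iff.1 (Part.mem_coe.1 hx)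
    exact ⟨ho, fun m hm => by simpa using Part.mem_some_iff.1 (Nat.rfind_min hs hm)⟩
  · rintro ⟨h, hm⟩
    refine ⟨Nat.mem_rfind.2 ⟨Part.mem_some_iff.2 ?_, fun {m} hms => Part.mem_some_iff.2 ?_⟩,
      Part.mem_coe.2 (Option.bind_eq_some_iff.2 ⟨_, h, rfl⟩)⟩
    · rw [Option.mem_def.1 h]; rfl
    · rw [hm m hms]; rfl

/-- All programs search the same enumeration of computations. If the search for `p` stops at `p`
itself, that index is also a hit for every `q` comparable with `p`. With `p` and `q` both
successful, each first index bounds the other, so they coincide and decode to the same program. -/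
theorem prefixFreed_eq_of_prefix {c : Code} {p q y x x' : BStr}
    (hp : x ∈ prefixFreed c p y) (hq : x' ∈ prefixFreed c q y) (h : p <+: q) : p = q := by
  have key : ∀ {p q y x : BStr} {s t : ℕ}, some x ∈ prefixStep c p y s →
      (∀ m < t, prefixStep c q y m = none) → (p <+: q ∨ q <+: p) → t ≤ s := by
    intro p q y x s t hs ht hpq
    by_contra! hlt
    obtain ⟨p', k, x', h1, h2, -, h3⟩ := mem_prefixStep.1 hs
    obtain rfl : p' = p := by by_contra hne; simp [hne] at h3
    have := ht s hlt
    have h4 := mem_prefixStep.2 ⟨p', k, x', h1, h2, hpq, rfl⟩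
    simp [this] at h4
  obtain ⟨s, hs, hs'⟩ := mem_prefixFreed.1 hp
  obtain ⟨t, ht, ht'⟩ := mem_prefixFreed.1 hq
  obtain rfl : s = t := le_antisymm (key ht hs' (Or.inr h)) (key hs ht' (Or.inl h))
  obtain ⟨p', k, x', h1, -, -, h3⟩ := mem_prefixStep.1 hs
  obtain ⟨q', k', x'', h1', -, -, h3'⟩ := mem_prefixStep.1 ht
  obtain rfl : p' = p := by by_contra hne; simp [hne] at h3
  obtain rfl : q' = q := by by_contra hne; simp [hne] at h3'
  rw [h1] at h1'
  simp only [Option.some.injEq, Prod.mk.injEq] at h1'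
  exact h1'.1

/-- In a prefix machine the only halting program comparable with `p` is `p`, so the first hit is
already the right one. -/
theorem subset_prefixFreed {M : BStr → BStr →. BStr} (hM : IsPrefixMachine M) {c : Code}
    (hc : ∀ p y x, x ∈ M p y ↔ ∃ k, x ∈ stage BStr c k (p, y)) {p y x : BStr} (h : x ∈ M p y) :
    x ∈ prefixFreed c p y := by
  obtain ⟨k, hk⟩ := (hc p y x).1 h
  have hex : ∃ s, (prefixStep c p y s).isSome := by
    refine ⟨encode (p, k), Option.isSome_iff_exists.2 ⟨_, mem_prefixStep.2
      ⟨p, k, x, encodek _, hk, Or.inl (List.prefix_refl p), rfl⟩⟩⟩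
  classical
  refine mem_prefixFreed.2 ⟨Nat.find hex, ?_, fun m hm => by simpa using Nat.find_min hex hm⟩
  obtain ⟨o, ho⟩ := Option.isSome_iff_exists.1 (Nat.find_spec hex)
  obtain ⟨q, k', x', h1, h2, h3, rfl⟩ := mem_prefixStep.1 ho
  have h2' := (hc q y x').2 ⟨k', h2⟩
  obtain ⟨rfl, rfl⟩ : q = p ∧ x' = x := by
    rcases h3 with h3 | h3
    · exact hM.eq_of_prefix h2' h h3
    · exact (hM.eq_of_prefix h h2' h3).imp Eq.symm Eq.symm
  simpa using ho

/-- Parse a string of the form `0ⁱ1p` as `(i, p)`. -/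
def unaryParse : BStr → Option (ℕ × BStr)
  | [] => none
  | true :: p => some (0, p)
  | false :: p => (unaryParse p).map fun e => (e.1 + 1, e.2)

theorem unaryParse_append (i : ℕ) (p : BStr) :
    unaryParse (List.replicate i false ++ true :: p) = some (i, p) := by
  induction i with
  | zero => rfl
  | succ i ih => simp [List.replicate_succ, unaryParse, ih]

theorem eq_of_unaryParse {r p : BStr} {i : ℕ} (h : unaryParse r = some (i, p)) :
    r = List.replicate i false ++ true :: p := by
  induction r generalizing i with
  | nil => simp [unaryParse] at h
  | cons b r ih =>
    cases b with
    | true =>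
      simp only [unaryParse, Option.some.injEq, Prod.mk.injEq] at h
      obtain ⟨rfl, rfl⟩ := h
      rfl
    | false =>
      simp only [unaryParse, Option.map_eq_some_iff, Prod.mk.injEq, Prod.exists] at h
      obtain ⟨j, q, hj, rfl, rfl⟩ := h
      rw [ih hj]
      rfl

theorem primrec_unaryParse : Primrec unaryParse := by
  refine (Primrec.list_rec (f := id) (g := fun _ => (none : Option (ℕ × BStr)))
    (h := fun _ (t : Bool × BStr × Option (ℕ × BStr)) =>
      bif t.1 then some (0, t.2.1) else t.2.2.map fun e => (e.1 + 1, e.2))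
    Primrec.id (Primrec.const none) ?_).of_eq fun r => ?_
  · refine Primrec.cond (Primrec.fst.comp Primrec.snd) ?_ ?_
    · exact Primrec.option_some.comp
        ((Primrec.const 0).pair (Primrec.fst.comp (Primrec.snd.comp Primrec.snd)))
    · refine Primrec.option_map (Primrec.snd.comp (Primrec.snd.comp Primrec.snd)) ?_
      exact (Primrec.succ.comp (Primrec.fst.comp Primrec.snd)).pair
        (Primrec.snd.comp Primrec.snd)
  · induction r with
    | nil => rfl
    | cons b r ih =>
      simp only [id] at ih ⊢
      cases b <;> simp [unaryParse, ← ih]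

/-- The universal prefix machine: `0ⁱ1p` runs the `i`-th prefix machine on `p`. -/
def universalMachine (r y : BStr) : Part BStr :=
  (unaryParse r : Part (ℕ × BStr)).bind fun e => prefixFreed (Denumerable.ofNat Code e.1) e.2 y

theorem mem_universalMachine {r y x : BStr} : x ∈ universalMachine r y ↔
    ∃ i p, r = List.replicate i false ++ true :: p ∧
      x ∈ prefixFreed (Denumerable.ofNat Code i) p y := by
  simp only [universalMachine, Part.mem_bind_iff, Part.mem_coe, Option.mem_def, Prod.exists]
  constructor
  · rintro ⟨i, p, h, hx⟩
    exact ⟨i, p, eq_of_unaryParse h, hx⟩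
  · rintro ⟨i, p, rfl, hx⟩
    exact ⟨i, p, unaryParse_append i p, hx⟩

theorem replicate_prefix {i j : ℕ} {p q : BStr}
    (h : List.replicate i false ++ true :: p <+: List.replicate j false ++ true :: q) :
    i = j ∧ p <+: q := by
  obtain ⟨r, hr⟩ := h
  have := unaryParse_append j q
  rw [← hr, List.append_assoc, List.cons_append, unaryParse_append] at this
  simp only [Option.some.injEq, Prod.mk.injEq] at this
  exact ⟨this.1, r, this.2⟩

theorem partrec_universalMachine : Partrec₂ (universalMachine : BStr → BStr →. BStr) := by
  have h₁ : Partrec fun t : BStr × BStr => (unaryParse t.1 : Part (ℕ × BStr)) :=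
    (primrec_unaryParse.comp Primrec.fst).to_comp.ofOption
  have h₂ : Primrec fun t : (BStr × BStr) × (ℕ × BStr) =>
      ((Denumerable.ofNat Code t.2.1, t.2.2), t.1.2) :=
    (((Primrec.ofNat Code).comp (Primrec.fst.comp Primrec.snd)).pair
      (Primrec.snd.comp Primrec.snd)).pair (Primrec.snd.comp Primrec.fst)
  have h₃ := partrec_prefixFreed.comp h₂.to_comp
  exact h₁.bind h₃.to₂

theorem universalMachine_prefix_free (y r r' : BStr) (hr : (universalMachine r y).Dom)
    (hr' : (universalMachine r' y).Dom) (hpre : r <+: r') : r = r' := by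
  obtain ⟨x, hx⟩ := Part.dom_iff_mem.1 hr
  obtain ⟨x', hx'⟩ := Part.dom_iff_mem.1 hr'
  obtain ⟨i, p, rfl, hp⟩ := mem_universalMachine.1 hx
  obtain ⟨j, q, rfl, hq⟩ := mem_universalMachine.1 hx'
  obtain ⟨rfl, hpq⟩ := replicate_prefix hpre
  rw [prefixFreed_eq_of_prefix hp hq hpq]

theorem isUniversalPrefixMachine_universalMachine :
    IsUniversalPrefixMachine universalMachine where
  isPrefixMachine := ⟨partrec_universalMachine, universalMachine_prefix_free⟩
  optimal M hM := by
    obtain ⟨c, hc⟩ := exists_stage (α := BStr × BStr) (β := BStr) hM.partrec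
    obtain ⟨i, rfl⟩ : ∃ i, Denumerable.ofNat Code i = c := ⟨encode c, Denumerable.ofNat_encode c⟩
    refine ⟨i + 1, fun p y x hx => ⟨List.replicate i false ++ true :: p,
      mem_universalMachine.2 ⟨i, p, rfl, ?_⟩, ?_⟩⟩
    · exact subset_prefixFreed hM (fun p y x => hc (p, y) x) hx
    · rw [List.length_append, List.length_replicate, List.length_cons]
      omega

/-! ### The Kraft inequality -/

/-- The leading words of two factorizations are prefixes of one string, hence comparable and equal,
and can be cancelled. The empty word must be excluded: `{[]}` is prefix-free but not uniquely
decodable. -/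
theorem uniquelyDecodable_of_prefix_free {α : Type*} {S : Set (List α)} (hnil : [] ∉ S)
    (hS : ∀ p ∈ S, ∀ q ∈ S, p <+: q → p = q) : InformationTheory.UniquelyDecodable S := by
  intro L₁
  induction L₁ with
  | nil =>
    intro L₂ _ h₂ h
    cases L₂ with
    | nil => rfl
    | cons q L₂ =>
      simp only [List.flatten_nil, List.flatten_cons, List.nil_eq, List.append_eq_nil_iff] at h
      exact absurd (h.1 ▸ h₂ q (by simp)) hnil
  | cons p L₁ ih =>
    intro L₂ h₁ h₂ h
    cases L₂ with
    | nil =>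
      simp only [List.flatten_nil, List.flatten_cons, List.append_eq_nil_iff] at h
      exact absurd (h.1 ▸ h₁ p (by simp)) hnil
    | cons q L₂ =>
      simp only [List.flatten_cons] at h
      have hp := h₁ p (by simp)
      have hq := h₂ q (by simp)
      obtain rfl : p = q := by
        rcases List.prefix_or_prefix_of_prefix (List.prefix_append p L₁.flatten)
          (h ▸ List.prefix_append q L₂.flatten) with hpq | hpq
        · exact hS p hp q hq hpq
        · exact (hS q hq p hp hpq).symm
      rw [ih L₂ (fun w hw => h₁ w (by simp [hw])) (fun w hw => h₂ w (by simp [hw]))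
        (List.append_cancel_left h)]

/-! ### Shortest programs of a universal machine and the Kraft sum -/

variable {U : BStr → BStr →. BStr}

theorem IsUniversalPrefixMachine.exists_program (hU : IsUniversalPrefixMachine U) (x y : BStr) :
    ∃ p, x ∈ U p y := by
  obtain ⟨c, hc⟩ := hU.optimal _ (isPrefixMachine_nil (Primrec.const x))
  obtain ⟨q, hq, -⟩ := hc [] y x (mem_nilMachine (fun _ => x) y)
  exact ⟨q, hq⟩

theorem IsUniversalPrefixMachine.exists_program_length_eq_K (hU : IsUniversalPrefixMachine U)
    (x y : BStr) : ∃ p, x ∈ U p y ∧ p.length = K U x y := by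
  obtain ⟨p, hp⟩ := hU.exists_program x y
  exact Nat.sInf_mem (s := {n : ℕ | ∃ p : BStr, x ∈ U p y ∧ p.length = n}) ⟨_, p, hp, rfl⟩

theorem K_le_length {x y p : BStr} (h : x ∈ U p y) : K U x y ≤ p.length :=
  Nat.sInf_le ⟨p, h, rfl⟩

/-- A halting empty program would be the only halting one under `y`, yet every string must be an
output. Consequently `K` and `E` are strictly positive, even on the diagonal. -/
theorem IsUniversalPrefixMachine.nil_not_dom (hU : IsUniversalPrefixMachine U) (y : BStr) :
    ¬ (U [] y).Dom := by
  intro h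
  have key : ∀ x, x ∈ U [] y := fun x => by
    obtain ⟨p, hp⟩ := hU.exists_program x y
    rwa [hU.isPrefixMachine.prefix_free y [] p h (Part.dom_iff_mem.2 ⟨x, hp⟩) List.nil_prefix]
  exact absurd (Part.mem_unique (key []) (key [true])) (by simp)

theorem IsUniversalPrefixMachine.K_pos (hU : IsUniversalPrefixMachine U) (x y : BStr) :
    0 < K U x y := by
  obtain ⟨p, hp, hl⟩ := hU.exists_program_length_eq_K x y
  rw [← hl, List.length_pos_iff]
  rintro rfl
  exact hU.nil_not_dom y (Part.dom_iff_mem.2 ⟨x, hp⟩)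

theorem IsUniversalPrefixMachine.kraft (hU : IsUniversalPrefixMachine U) (y : BStr) :
    ∑' x, ENNReal.ofReal ((1 / 2 : ℝ) ^ K U x y) ≤ 1 := by
  choose p hp hl using fun x => hU.exists_program_length_eq_K x y
  have hinj : Function.Injective p := fun x x' h => Part.mem_unique (hp x) (h ▸ hp x')
  rw [ENNReal.tsum_eq_iSup_sum]
  refine iSup_le fun s => ?_
  have hud : InformationTheory.UniquelyDecodable ((s.map ⟨p, hinj⟩ : Finset BStr) : Set BStr) := by
    apply uniquelyDecodable_of_prefix_free
    · simp only [Finset.coe_map, Function.Embedding.coeFn_mk, Set.mem_image, not_exists, not_and]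
      intro x _ hx
      exact hU.nil_not_dom y (hx ▸ Part.dom_iff_mem.2 ⟨x, hp x⟩)
    · simp only [Finset.coe_map, Function.Embedding.coeFn_mk, Set.forall_mem_image]
      exact fun x _ x' _ h => (hU.isPrefixMachine.eq_of_prefix (hp x) (hp x') h).1
  have := InformationTheory.kraft_mcmillan_inequality hud
  rw [← ENNReal.ofReal_sum_of_nonneg (fun _ _ => by positivity)]
  refine ENNReal.ofReal_le_one.2 ?_
  simpa [hl] using this

/-! ### The Kraft–Chaitin construction -/

/-- The natural number with the given binary expansion, most significant digit first. -/
def binVal (p : BStr) : ℕ := p.foldl (fun n b => 2 * n + b.toNat) 0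

theorem binVal_append_singleton (p : BStr) (b : Bool) :
    binVal (p ++ [b]) = 2 * binVal p + b.toNat := by
  simp [binVal]

/-- The dyadic interval `[binVal p / 2 ^ |p|, (binVal p + 1) / 2 ^ |p|)` contains that of every
extension of `p`. -/
theorem binVal_append (p r : BStr) :
    binVal p * 2 ^ r.length ≤ binVal (p ++ r) ∧
      binVal (p ++ r) + 1 ≤ (binVal p + 1) * 2 ^ r.length := by
  induction r using List.reverseRecOn with
  | nil => simp
  | append_singleton r b ih =>
    rw [← List.append_assoc, binVal_append_singleton, List.length_append, List.length_singleton,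
      pow_succ]
    have := b.toNat_le
    constructor <;> nlinarith [ih.1, ih.2]

theorem exists_binVal_eq (n a : ℕ) (h : a < 2 ^ n) : ∃ p : BStr, p.length = n ∧ binVal p = a := by
  induction n generalizing a with
  | zero => exact ⟨[], rfl, by simp at h; simp [binVal, h]⟩
  | succ n ih =>
    obtain ⟨p, hp, hv⟩ := ih (a / 2) (by rw [pow_succ] at h; omega)
    refine ⟨p ++ [decide (a % 2 = 1)], by simp [hp], ?_⟩
    rw [binVal_append_singleton, hv]
    by_cases h1 : a % 2 = 1
    · simp only [h1, decide_true, Bool.toNat_true]; omega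
    · simp only [h1, decide_false, Bool.toNat_false]; omega

theorem primrec_pow : Primrec₂ ((· ^ ·) : ℕ → ℕ → ℕ) :=
  Primrec₂.unpaired'.1 Nat.Primrec.pow

theorem primrec_binVal : Primrec binVal := by
  refine Primrec.list_foldl (f := fun p : BStr => p) (g := fun _ => 0)
    (h := fun _ t => 2 * t.1 + t.2.toNat) Primrec.id (Primrec.const 0) ?_
  exact Primrec.nat_add.comp
    (Primrec.nat_mul.comp (Primrec.const 2) (Primrec.fst.comp Primrec.snd))
    ((Primrec.dom_bool Bool.toNat).comp (Primrec.snd.comp Primrec.snd))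

/-- The weight of the `s`-th request, if any. -/
noncomputable def requestWeight (f : ℕ → Option (BStr × ℕ)) (s : ℕ) : ℝ :=
  (f s).elim 0 fun e => (1 / 2) ^ e.2

theorem requestWeight_nonneg (f : ℕ → Option (BStr × ℕ)) (s : ℕ) : 0 ≤ requestWeight f s := by
  unfold requestWeight
  cases f s <;> simp

/-- The total weight of the first `s` requests, scaled by `2 ^ (s + 2)`. -/
def scaledWeight (f : ℕ → Option (BStr × ℕ)) : ℕ → ℕ
  | 0 => 0
  | s + 1 => 2 * scaledWeight f s + (f s).elim 0 fun e => 4 * 2 ^ (s + 1 - e.2)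

/-- The bound `e.2 ≤ s + 1` keeps the truncated subtraction exact, so allocation can be done in
integer arithmetic. -/
theorem scaledWeight_eq {f : ℕ → Option (BStr × ℕ)} (hf : ∀ s e, e ∈ f s → e.2 ≤ s + 1) (s : ℕ) :
    (scaledWeight f s : ℝ) = 2 ^ (s + 2) * ∑ t ∈ Finset.range s, requestWeight f t := by
  induction s with
  | zero => simp [scaledWeight]
  | succ s ih =>
    rw [Finset.sum_range_succ, scaledWeight, Nat.cast_add, Nat.cast_mul, ih, requestWeight]
    cases h : f s with
    | none => simp; ring
    | some e =>
      obtain ⟨d, hd⟩ := Nat.exists_eq_add_of_le (hf s e h)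
      have h2 : s + 1 - e.2 = d := by omega
      have h3 : s + 1 + 2 = 2 + d + e.2 := by omega
      have h4 : (2 : ℝ) ^ e.2 * (1 / 2) ^ e.2 = 1 := by rw [← mul_pow]; norm_num
      simp only [Option.elim_some, h2, mul_add]
      congr 1
      · push_cast; ring
      · rw [h3, pow_add, mul_assoc, h4, pow_add]; push_cast; ring

theorem primrec_scaledWeight {f : BStr → ℕ → Option (BStr × ℕ)} (hf : Primrec₂ f) :
    Primrec₂ fun y s => scaledWeight (f y) s := by
  have : Primrec₂ fun y s => Nat.rec (motive := fun _ => ℕ) 0 (fun s n => 2 * n +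
      ((f y s).map fun e => 4 * 2 ^ (s + 1 - e.2)).getD 0) s := by
    refine Primrec.nat_rec (f := fun _ : BStr => 0) (g := fun y t => 2 * t.2 +
      ((f y t.1).map fun e => 4 * 2 ^ (t.1 + 1 - e.2)).getD 0) (Primrec.const 0) ?_
    refine Primrec.nat_add.comp
      (Primrec.nat_mul.comp (Primrec.const 2) (Primrec.snd.comp Primrec.snd)) ?_
    refine Primrec.option_getD.comp (Primrec.option_map
      (hf.comp Primrec.fst (Primrec.fst.comp Primrec.snd)) ?_) (Primrec.const 0)
    refine Primrec.nat_mul.comp (Primrec.const 4) (primrec_pow.comp (Primrec.const 2) ?_)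
    exact Primrec.nat_sub.comp
      (Primrec.succ.comp (Primrec.fst.comp (Primrec.snd.comp Primrec.fst)))
      (Primrec.snd.comp Primrec.snd)
  refine this.of_eq fun y s => ?_
  induction s with
  | zero => rfl
  | succ s ih =>
    rw [scaledWeight, ← ih]
    cases h : f y s <;> simp [h]

/-- The program `p` codes the request `s` for an output at length `l`: it has length `l + 1`, and
its dyadic interval is the first one of that length in the interval allotted to the request. -/
def IsCodeword (f : ℕ → Option (BStr × ℕ)) (p : BStr) (s l : ℕ) : Prop :=
  p.length = l + 1 ∧ scaledWeight f s ≤ binVal p * 2 ^ (s + 1 - l) ∧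
    binVal p * 2 ^ (s + 1 - l) < scaledWeight f s + 2 ^ (s + 1 - l)

instance (f : ℕ → Option (BStr × ℕ)) (p : BStr) (s l : ℕ) : Decidable (IsCodeword f p s l) :=
  inferInstanceAs (Decidable (_ ∧ _ ∧ _))

/-- Request `s` owns the interval between consecutive partial sums, of length `2 ^ (-l)`. Rounding
its left end up to a multiple of `2 ^ (-(l + 1))` costs less than half of it; this is the reason for
the extra bit. -/
theorem IsCodeword.interval {f : ℕ → Option (BStr × ℕ)} (hf : ∀ s e, e ∈ f s → e.2 ≤ s + 1)
    {p : BStr} {s : ℕ} {e : BStr × ℕ} (he : e ∈ f s) (h : IsCodeword f p s e.2) :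
    ∑ t ∈ Finset.range s, requestWeight f t ≤ binVal p / 2 ^ p.length ∧
      (binVal p + 1) / 2 ^ p.length ≤ ∑ t ∈ Finset.range (s + 1), requestWeight f t := by
  obtain ⟨hl, h1, h2⟩ := h
  obtain ⟨d, hd⟩ := Nat.exists_eq_add_of_le (hf s e he)
  have h3 : s + 1 - e.2 = d := by omega
  have hs := scaledWeight_eq hf s
  have hp : (2 : ℝ) ^ (s + 2) = 2 ^ d * 2 ^ p.length := by
    rw [← pow_add]; congr 1; omega
  rw [h3] at h1 h2
  rw [hp] at hs
  have h1' : (scaledWeight f s : ℝ) ≤ binVal p * 2 ^ d := by exact_mod_cast h1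
  have h2' : (binVal p : ℝ) * 2 ^ d < scaledWeight f s + 2 ^ d := by exact_mod_cast h2
  have hd0 : (0 : ℝ) < 2 ^ d := by positivity
  rw [Finset.sum_range_succ]
  set S := ∑ t ∈ Finset.range s, requestWeight f t
  have hw : requestWeight f s = 2 / 2 ^ p.length := by
    simp only [requestWeight, Option.mem_def.1 he, Option.elim_some, hl, pow_succ, one_div,
      inv_pow]
    field_simp
  constructor
  · rw [le_div_iff₀ (by positivity)]
    refine le_of_mul_le_mul_left ?_ hd0
    linarith
  · rw [hw, div_le_iff₀ (by positivity), add_mul, div_mul_cancel₀ _ (by positivity)]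
    refine le_of_mul_le_mul_left ?_ hd0
    linarith

/-- Comparable codewords have nested intervals, while distinct requests own disjoint ones; within
one request the lengths agree. -/
theorem codeword_prefix_free {f : ℕ → Option (BStr × ℕ)} (hf : ∀ s e, e ∈ f s → e.2 ≤ s + 1)
    {p q : BStr} {s t : ℕ} {e e' : BStr × ℕ} (he : e ∈ f s) (he' : e' ∈ f t)
    (hp : IsCodeword f p s e.2) (hq : IsCodeword f q t e'.2) (hpq : p <+: q) : s = t ∧ p = q := by
  have hmono : Monotone fun n => ∑ t ∈ Finset.range n, requestWeight f t := fun m n h =>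
    Finset.sum_le_sum_of_subset_of_nonneg (Finset.range_mono h)
      fun _ _ _ => requestWeight_nonneg f _
  obtain ⟨r, rfl⟩ := hpq
  obtain ⟨hp1, hp2⟩ := hp.interval hf he
  obtain ⟨hq1, hq2⟩ := hq.interval hf he'
  have h1 : (binVal p : ℝ) / 2 ^ p.length ≤ binVal (p ++ r) / 2 ^ (p ++ r).length := by
    rw [List.length_append, pow_add, div_le_div_iff₀ (by positivity) (by positivity)]
    have : (binVal p * 2 ^ r.length : ℝ) ≤ binVal (p ++ r) := by
      exact_mod_cast (binVal_append p r).1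
    nlinarith [pow_pos (two_pos (α := ℝ)) p.length]
  have h2 : ((binVal (p ++ r) : ℝ) + 1) / 2 ^ (p ++ r).length ≤ (binVal p + 1) / 2 ^ p.length := by
    rw [List.length_append, pow_add, div_le_div_iff₀ (by positivity) (by positivity)]
    have : (binVal (p ++ r) + 1 : ℝ) ≤ (binVal p + 1) * 2 ^ r.length := by
      exact_mod_cast (binVal_append p r).2
    nlinarith [pow_pos (two_pos (α := ℝ)) p.length]
  have h3 : (binVal (p ++ r) : ℝ) / 2 ^ (p ++ r).length <
      (binVal (p ++ r) + 1) / 2 ^ (p ++ r).length := by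
    gcongr; linarith
  obtain rfl : s = t := by
    rcases lt_trichotomy s t with h | h | h
    · have := hmono (Nat.succ_le_of_lt h)
      simp only [Nat.succ_eq_add_one] at this
      linarith
    · exact h
    · have := hmono (Nat.succ_le_of_lt h)
      simp only [Nat.succ_eq_add_one] at this
      linarith
  obtain rfl := Option.mem_unique he he'
  have := hp.1.trans hq.1.symm
  exact ⟨rfl, (List.prefix_append p r).eq_of_length this⟩

theorem exists_codeword {f : ℕ → Option (BStr × ℕ)} (hf : ∀ s e, e ∈ f s → e.2 ≤ s + 1)
    {s : ℕ} {e : BStr × ℕ} (he : e ∈ f s)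
    (hsum : ∑ t ∈ Finset.range (s + 1), requestWeight f t ≤ 1) : ∃ p, IsCodeword f p s e.2 := by
  obtain ⟨d, hd⟩ := Nat.exists_eq_add_of_le (hf s e he)
  have h3 : s + 1 - e.2 = d := by omega
  have hd0 : 0 < 2 ^ d := by positivity
  have hT : scaledWeight f (s + 1) ≤ 2 ^ (s + 3) := by
    have h := scaledWeight_eq hf (s + 1)
    have : (scaledWeight f (s + 1) : ℝ) ≤ 2 ^ (s + 3) := by
      rw [h]
      exact mul_le_of_le_one_right (by positivity) hsum
    exact_mod_cast this
  rw [scaledWeight, Option.mem_def.1 he, Option.elim_some, h3] at hT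
  have hpow : 2 ^ (s + 3) = 2 * (2 ^ d * 2 ^ (e.2 + 1)) := by
    rw [← pow_add, ← pow_succ']; congr 1; omega
  -- The left end rounded up: the ceiling of `scaledWeight f s / 2 ^ d`. The total weight bound
  -- makes it fit in `e.2 + 1` bits.
  set a := (scaledWeight f s + 2 ^ d - 1) / 2 ^ d
  have ha1 : a * 2 ^ d ≤ scaledWeight f s + 2 ^ d - 1 := Nat.div_mul_le_self _ _
  have ha2 : scaledWeight f s + 2 ^ d - 1 < 2 ^ d * (a + 1) := Nat.lt_mul_div_succ _ hd0
  have ha : a < 2 ^ (e.2 + 1) := by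
    by_contra! hcon
    have := Nat.mul_le_mul_left (2 ^ d) hcon
    rw [mul_comm a] at ha1
    omega
  obtain ⟨p, hl, hv⟩ := exists_binVal_eq _ _ ha
  refine ⟨p, hl, ?_, ?_⟩
  · rw [hv, h3]
    rw [mul_add, mul_comm _ a] at ha2
    omega
  · rw [hv, h3]
    omega

/-- **Kraft–Chaitin theorem.** A computable sequence of requests `(x, l)`, for each condition `y`,
with total weight `∑ 2 ^ (-l) ≤ 1` is served by a prefix machine with programs of length `l + 1`. -/
theorem exists_machine_of_requests {f : BStr → ℕ → Option (BStr × ℕ)} (hf : Primrec₂ f)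
    (hlen : ∀ y s e, e ∈ f y s → e.2 ≤ s + 1)
    (hsum : ∀ y n, ∑ t ∈ Finset.range n, requestWeight (f y) t ≤ 1) :
    ∃ M : BStr → BStr →. BStr, IsPrefixMachine M ∧
      ∀ y s x l, (x, l) ∈ f y s → ∃ p, x ∈ M p y ∧ p.length = l + 1 := by
  let h : BStr × BStr → ℕ → Option BStr := fun t s =>
    (f t.2 s).bind fun e => if IsCodeword (f t.2) t.1 s e.2 then some e.1 else none
  have hcomp : Computable₂ h := by
    refine Primrec.to_comp (f := fun t : (BStr × BStr) × ℕ => h t.1 t.2) ?_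
    refine Primrec.option_bind (hf.comp (Primrec.snd.comp Primrec.fst) Primrec.snd) ?_
    have hp : Primrec fun t : ((BStr × BStr) × ℕ) × (BStr × ℕ) => t.1.1.1 :=
      Primrec.fst.comp (Primrec.fst.comp Primrec.fst)
    have hl : Primrec fun t : ((BStr × BStr) × ℕ) × (BStr × ℕ) => t.2.2 :=
      Primrec.snd.comp Primrec.snd
    have hs : Primrec fun t : ((BStr × BStr) × ℕ) × (BStr × ℕ) => t.1.2 :=
      Primrec.snd.comp Primrec.fst
    have hT : Primrec fun t : ((BStr × BStr) × ℕ) × (BStr × ℕ) =>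
        scaledWeight (f t.1.1.2) t.1.2 :=
      (primrec_scaledWeight hf).comp (Primrec.snd.comp (Primrec.fst.comp Primrec.fst)) hs
    have hu : Primrec fun t : ((BStr × BStr) × ℕ) × (BStr × ℕ) => 2 ^ (t.1.2 + 1 - t.2.2) :=
      primrec_pow.comp (Primrec.const 2) (Primrec.nat_sub.comp (Primrec.succ.comp hs) hl)
    have hv := Primrec.nat_mul.comp (primrec_binVal.comp hp) hu
    refine Primrec.ite (PrimrecPred.and ?_ (PrimrecPred.and ?_ ?_))
      (Primrec.option_some.comp (Primrec.fst.comp Primrec.snd)) (Primrec.const none)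
    · exact Primrec.eq.comp (Primrec.list_length.comp hp) (Primrec.succ.comp hl)
    · exact Primrec.nat_le.comp hT hv
    · exact Primrec.nat_lt.comp hv (Primrec.nat_add.comp hT hu)
  have sound : ∀ p y s x, x ∈ h (p, y) s → ∃ l, (x, l) ∈ f y s ∧ IsCodeword (f y) p s l := by
    intro p y s x hx
    simp only [h, Option.mem_def, Option.bind_eq_some_iff, Option.ite_none_right_eq_some,
      Option.some.injEq] at hx
    obtain ⟨e, he, hc, rfl⟩ := hx
    exact ⟨e.2, he, hc⟩
  refine ⟨searchMachine h, ⟨searchMachine_partrec hcomp, ?_⟩, ?_⟩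
  · intro y p q hp hq hpre
    obtain ⟨s, x, hx⟩ := searchMachine_dom.1 hp
    obtain ⟨t, x', hx'⟩ := searchMachine_dom.1 hq
    obtain ⟨l, hl, hc⟩ := sound _ _ _ _ hx
    obtain ⟨l', hl', hc'⟩ := sound _ _ _ _ hx'
    exact (codeword_prefix_free (hlen y) hl hl' hc hc' hpre).2
  · intro y s x l hx
    obtain ⟨p, hp⟩ := exists_codeword (hlen y) hx (hsum y (s + 1))
    refine ⟨p, mem_searchMachine (s := s) ?_ ?_, hp.1⟩
    · simp only [h, Option.mem_def] at hx ⊢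
      simp only [hx, Option.bind_some, if_pos hp]
    · intro t x' hx'
      obtain ⟨l', hl', hc'⟩ := sound _ _ _ _ hx'
      obtain ⟨rfl, -⟩ := codeword_prefix_free (hlen y) hl' hx hc' hp (List.prefix_refl p)
      have := Option.mem_unique hl' hx
      simp only [Prod.mk.injEq] at this
      exact this.1

/-! ### Minimality among the upper semicomputable distances -/

/-- The requests of a distance `D` for which `(x, y, n, 0) ↦ D x y < n` is semidecided by `c`:
a request `(x, n + 1)` for every `x ≠ y` and `n` with `D y x < n`. -/
def distanceRequest (c : Code) (y : BStr) (s : ℕ) : Option (BStr × ℕ) :=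
  -- `decode₂` rejects indices that are not encodings, and the test selects the first successful
  -- step bound `k + 1`; thus each pair `(x, n)` is requested at most once.
  (decode₂ ((BStr × ℕ) × ℕ) s).bind fun e =>
    if e.1.1 ≠ y ∧ (Code.evaln (e.2 + 1) c (encode ((y, e.1.1), (e.1.2, 0)))).isSome = true ∧
      (Code.evaln e.2 c (encode ((y, e.1.1), (e.1.2, 0)))).isSome = false
    then some (e.1.1, e.1.2 + 1) else none

theorem primrec_distanceRequest (c : Code) : Primrec₂ (distanceRequest c) := by
  refine Primrec.option_bind (Primrec.decode₂.comp Primrec.snd) ?_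
  have hy : Primrec fun t : (BStr × ℕ) × ((BStr × ℕ) × ℕ) => t.1.1 :=
    Primrec.fst.comp Primrec.fst
  have hx : Primrec fun t : (BStr × ℕ) × ((BStr × ℕ) × ℕ) => t.2.1.1 :=
    Primrec.fst.comp (Primrec.fst.comp Primrec.snd)
  have hn : Primrec fun t : (BStr × ℕ) × ((BStr × ℕ) × ℕ) => t.2.1.2 :=
    Primrec.snd.comp (Primrec.fst.comp Primrec.snd)
  have hk : Primrec fun t : (BStr × ℕ) × ((BStr × ℕ) × ℕ) => t.2.2 :=
    Primrec.snd.comp Primrec.snd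
  have he := Primrec.encode.comp ((hy.pair hx).pair (hn.pair (Primrec.const 0)))
  refine Primrec.ite (PrimrecPred.and ?_ (PrimrecPred.and ?_ ?_))
    (Primrec.option_some.comp (hx.pair (Primrec.succ.comp hn))) (Primrec.const none)
  · exact (Primrec.eq.comp hx hy).not
  · exact Primrec.eq.comp (Primrec.option_isSome.comp (Code.primrec_evaln.comp
      (((Primrec.succ.comp hk).pair (Primrec.const c)).pair he))) (Primrec.const true)
  · exact Primrec.eq.comp (Primrec.option_isSome.comp (Code.primrec_evaln.comp
      ((hk.pair (Primrec.const c)).pair he))) (Primrec.const false)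

theorem distanceRequest_length_le {c : Code} {y : BStr} {s : ℕ} {e : BStr × ℕ}
    (he : e ∈ distanceRequest c y s) : e.2 ≤ s + 1 := by
  simp only [distanceRequest, Option.mem_def, Option.bind_eq_some_iff,
    Option.ite_none_right_eq_some, Option.some.injEq] at he
  obtain ⟨⟨⟨x, n⟩, k⟩, hd, -, rfl⟩ := he
  have := mem_decode₂.1 hd
  simp only [encode_prod_val, encode_nat] at this
  have h1 := Nat.left_le_pair (Nat.pair (encode x) n) k
  have h2 := Nat.right_le_pair (encode x) n
  simp only
  omega

theorem isSome_evaln_mono {c : Code} {k m n : ℕ} (h : k ≤ m)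
    (hk : (Code.evaln k c n).isSome) : (Code.evaln m c n).isSome := by
  obtain ⟨a, ha⟩ := Option.isSome_iff_exists.1 hk
  exact Option.isSome_iff_exists.2 ⟨a, Code.evaln_mono h ha⟩

theorem exists_distanceRequest {c : Code} {x y : BStr} {n : ℕ} (hxy : x ≠ y)
    (h : ∃ k, (Code.evaln k c (encode ((y, x), (n, 0)))).isSome) :
    ∃ s, (x, n + 1) ∈ distanceRequest c y s := by
  classical
  -- Evaluation with bound `0` never succeeds, so the first successful bound is a successor.
  obtain ⟨k, hk⟩ : ∃ k, Nat.find h = k + 1 := by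
    refine Nat.exists_eq_succ_of_ne_zero fun h0 => ?_
    have := Nat.find_spec h
    rw [h0] at this
    simp [Code.evaln] at this
  refine ⟨encode ((x, n), k), ?_⟩
  have h1 := hk ▸ Nat.find_spec h
  have h2 : (Code.evaln k c (encode ((y, x), (n, 0)))).isSome = false := by
    simpa using Nat.find_min h (m := k) (by omega)
  simp only [distanceRequest, encodek₂, Option.mem_def, Option.bind_some]
  exact if_pos ⟨hxy, h1, h2⟩

/-- The geometric tail sums to `2 ^ (-m)`, where `m` is the least natural number above `d`.
Requesting length `n + 1` rather than `n` is what makes all requests for one `x` cost at most `2 ^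
(-D y x)`. -/
theorem tsum_pow_of_lt_le {d : ℝ} (hd : 0 ≤ d) :
    ∑' n : ℕ, (if d < n then ENNReal.ofReal ((1 / 2 : ℝ) ^ (n + 1)) else 0) ≤
      ENNReal.ofReal ((2 : ℝ) ^ (-d)) := by
  set m := ⌊d⌋₊ + 1
  have hm : ∀ n : ℕ, d < n ↔ m ≤ n := fun n => by
    rw [← Nat.floor_lt hd]; rfl
  have hs : HasSum (fun n : ℕ => if d < n then (1 / 2 : ℝ) ^ (n + 1) else 0) ((1 / 2) ^ m) := by
    rw [← hasSum_nat_add_iff' m, Finset.sum_eq_zero, sub_zero]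
    · have := (hasSum_geometric_two).mul_left ((1 / 2 : ℝ) ^ (m + 1))
      have hm2 : (1 / 2 : ℝ) ^ (m + 1) * 2 = (1 / 2) ^ m := by rw [pow_succ]; ring
      rw [hm2] at this
      refine (congrArg (HasSum · _) (funext fun n => ?_)).mpr this
      rw [if_pos ((hm _).2 (Nat.le_add_left m n)), ← pow_add]
      congr 1
      omega
    · intro n hn
      rw [if_neg]
      rw [hm]
      simpa using hn
  have h0 : ∀ n : ℕ, 0 ≤ (if d < n then (1 / 2 : ℝ) ^ (n + 1) else 0) := fun n => by
    split_ifs <;> positivity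
  calc _ = ∑' n : ℕ, ENNReal.ofReal (if d < n then (1 / 2 : ℝ) ^ (n + 1) else 0) :=
        tsum_congr fun n => by split_ifs <;> simp
    _ = ENNReal.ofReal ((1 / 2) ^ m) := by
        rw [← ENNReal.ofReal_tsum_of_nonneg h0 hs.summable, hs.tsum_eq]
    _ ≤ _ := by
        refine ENNReal.ofReal_le_ofReal ?_
        rw [one_div, inv_pow, Real.rpow_neg (by norm_num), ← Real.rpow_natCast]
        refine inv_anti₀ (by positivity) (Real.rpow_le_rpow_of_exponent_le (by norm_num) ?_)
        exact ((hm m).2 le_rfl).le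

theorem sum_distanceRequest_le {D : BStr → BStr → ℝ} (hD : IsOffDiagAdmissible D) {c : Code}
    (hc : ∀ x y (n : ℕ), D x y < n ↔ ∃ k, (Code.evaln k c (encode ((x, y), (n, 0)))).isSome)
    (y : BStr) (N : ℕ) :
    ∑ t ∈ Finset.range N, requestWeight (distanceRequest c y) t ≤ 1 := by
  set w : ℕ → ℝ≥0∞ := fun s => ENNReal.ofReal (requestWeight (distanceRequest c y) s)
  have hsupp : Function.support w ⊆ Set.range (encode : (BStr × ℕ) × ℕ → ℕ) := by
    intro s hs
    by_contra hcon
    refine hs ?_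
    have : decode₂ ((BStr × ℕ) × ℕ) s = none := by
      refine Option.eq_none_iff_forall_not_mem.2 fun e he => hcon ⟨e, mem_decode₂.1 he⟩
    simp [w, requestWeight, distanceRequest, this]
  have hw0 : ∀ s, distanceRequest c y s = none → w s = 0 := fun s h => by
    simp [w, requestWeight, h]
  have hfirst : ∀ x (n : ℕ), ∑' k : ℕ, w (encode ((x, n), k)) ≤
      if x ≠ y then (if D y x < n then ENNReal.ofReal ((1 / 2 : ℝ) ^ (n + 1)) else 0) else 0 := by
    intro x n
    by_cases hex : ∃ k : ℕ, distanceRequest c y (encode ((x, n), k)) ≠ none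
    · obtain ⟨k, hk⟩ := hex
      have key : ∀ k : ℕ, distanceRequest c y (encode ((x, n), k)) ≠ none →
          x ≠ y ∧ (Code.evaln (k + 1) c (encode ((y, x), (n, 0)))).isSome = true ∧
            (Code.evaln k c (encode ((y, x), (n, 0)))).isSome = false := by
        intro k hk
        by_contra hcon
        refine hk ?_
        simp only [distanceRequest, encodek₂, Option.bind_some]
        exact if_neg hcon
      obtain ⟨h1, h2, h3⟩ := key k hk
      rw [tsum_eq_single k, if_pos h1, if_pos ((hc _ _ _).2 ⟨_, h2⟩)]
      · simp only [w, requestWeight, distanceRequest, encodek₂, Option.bind_some]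
        rw [if_pos ⟨h1, h2, h3⟩, Option.elim_some]
      · intro k' hk'
        by_contra hcon
        obtain ⟨-, h2', h3'⟩ := key k' fun h => hcon (hw0 _ h)
        rcases lt_or_gt_of_ne hk' with h | h
        · exact absurd (isSome_evaln_mono (Nat.succ_le_of_lt h) h2') (by rw [h3]; exact Bool.false_ne_true)
        · exact absurd (isSome_evaln_mono (Nat.succ_le_of_lt h) h2) (by rw [h3']; exact Bool.false_ne_true)
    · push Not at hex
      rw [tsum_congr fun k => hw0 _ (hex k), tsum_zero]
      exact zero_le
  have htotal : ∑' s, w s ≤ 1 := by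
    rw [← (encode_injective (α := (BStr × ℕ) × ℕ)).tsum_eq hsupp, ENNReal.tsum_prod',
      ENNReal.tsum_prod']
    calc _ ≤ ∑' x : BStr, ∑' n : ℕ, (if x ≠ y then
          (if D y x < n then ENNReal.ofReal ((1 / 2 : ℝ) ^ (n + 1)) else 0) else 0) :=
          ENNReal.tsum_le_tsum fun x => ENNReal.tsum_le_tsum fun n => hfirst x n
      _ ≤ ∑' x : BStr, ({x | x ≠ y} : Set BStr).indicator
          (fun x => ENNReal.ofReal ((2 : ℝ) ^ (-D y x))) x := by
          refine ENNReal.tsum_le_tsum fun x => ?_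
          by_cases h : x ≠ y
          · simp only [if_pos h]
            rw [Set.indicator_of_mem (show x ∈ {x | x ≠ y} from h)]
            exact tsum_pow_of_lt_le (hD.nonneg y x)
          · simp [h]
      _ = ∑' x : {x : BStr // x ≠ y}, ENNReal.ofReal ((2 : ℝ) ^ (-D y x)) :=
          (tsum_subtype _ _).symm
      _ ≤ 1 := hD.density y
  refine ENNReal.ofReal_le_one.1 ?_
  rw [ENNReal.ofReal_sum_of_nonneg fun _ _ => requestWeight_nonneg _ _]
  exact (ENNReal.sum_le_tsum _).trans htotal

/-! ### Upper bounds on complexity from optimality, and minimality of `E` -/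

theorem IsUniversalPrefixMachine.exists_K_le (hU : IsUniversalPrefixMachine U)
    {M : BStr → BStr →. BStr} (hM : IsPrefixMachine M) :
    ∃ c : ℕ, ∀ p y x, x ∈ M p y → K U x y ≤ p.length + c := by
  obtain ⟨c, hc⟩ := hU.optimal M hM
  refine ⟨c, fun p y x hx => ?_⟩
  obtain ⟨q, hq, hl⟩ := hc p y x hx
  exact (K_le_length hq).trans hl

theorem IsUniversalPrefixMachine.exists_K_self_le (hU : IsUniversalPrefixMachine U) :
    ∃ c : ℕ, ∀ x, K U x x ≤ c := by
  obtain ⟨c, hc⟩ := hU.exists_K_le (isPrefixMachine_nil Primrec.id)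
  exact ⟨c, fun x => by simpa using hc [] x x (mem_nilMachine id x)⟩

theorem IsUniversalPrefixMachine.exists_K_triangle (hU : IsUniversalPrefixMachine U) :
    ∃ c : ℕ, ∀ x y z, K U x y ≤ K U x z + K U z y + c := by
  obtain ⟨M, hM, hMU⟩ := exists_compMachine hU.isPrefixMachine
  obtain ⟨c, hc⟩ := hU.exists_K_le hM
  refine ⟨c, fun x y z => ?_⟩
  obtain ⟨p, hp, hpl⟩ := hU.exists_program_length_eq_K z y
  obtain ⟨q, hq, hql⟩ := hU.exists_program_length_eq_K x z
  have := hc _ _ _ (hMU p q x y z hp hq)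
  rw [List.length_append] at this
  omega

theorem E_nonneg (x y : BStr) : 0 ≤ E U x y := Nat.cast_nonneg _

theorem E_symm (x y : BStr) : E U x y = E U y x := by rw [E, E, max_comm]

theorem IsUniversalPrefixMachine.E_pos (hU : IsUniversalPrefixMachine U) (x y : BStr) :
    0 < E U x y :=
  Nat.cast_pos.2 (lt_max_of_lt_left (hU.K_pos x y))

theorem IsUniversalPrefixMachine.exists_E_le (hU : IsUniversalPrefixMachine U)
    {D : BStr → BStr → ℝ} (hD : IsOffDiagAdmissible D) :
    ∃ c : ℝ, ∀ x y, E U x y ≤ D x y + c := by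
  obtain ⟨k, hk⟩ := exists_evaln_of_rePred hD.upperSemicomputable
  have hk' : ∀ x y (n : ℕ), D x y < n ↔
      ∃ m, (Code.evaln m k (encode ((x, y), (n, 0)))).isSome := fun x y n => by
    rw [← hk ((x, y), (n, 0))]
    simp
  obtain ⟨M, hM, hMD⟩ := exists_machine_of_requests (primrec_distanceRequest k)
    (fun _ _ _ => distanceRequest_length_le) (sum_distanceRequest_le hD hk')
  obtain ⟨c, hc⟩ := hU.exists_K_le hM
  obtain ⟨c', hc'⟩ := hU.exists_K_self_le
  -- The `3` collects rounding `D y x` up to `n`, the request length `n + 1`, and the extra codeword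
  -- bit. The diagonal, where no request is made, is covered by `c'`.
  have hK : ∀ x y, (K U x y : ℝ) ≤ D y x + (c + c' + 3 : ℕ) := by
    intro x y
    have hD0 := hD.nonneg y x
    by_cases hxy : x = y
    · subst hxy
      have : (K U x x : ℝ) ≤ c' := by exact_mod_cast hc' x
      push_cast
      have : (0 : ℝ) ≤ c := c.cast_nonneg
      linarith
    · set n := ⌊D y x⌋₊ + 1
      have hn : D y x < n := by simpa [n] using Nat.lt_floor_add_one (D y x)
      have hn' : (n : ℝ) ≤ D y x + 1 := by
        simpa [n] using Nat.floor_le hD0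
      obtain ⟨s, hs⟩ := exists_distanceRequest hxy ((hk' y x n).1 hn)
      obtain ⟨p, hp, hl⟩ := hMD _ _ _ _ hs
      have h1 : K U x y ≤ n + 1 + 1 + c := hl ▸ hc p y x hp
      have h2 : (K U x y : ℝ) ≤ n + 1 + 1 + c := by exact_mod_cast h1
      push_cast
      have : (0 : ℝ) ≤ c' := c'.cast_nonneg
      linarith
  refine ⟨(c + c' + 3 : ℕ), fun x y => ?_⟩
  rw [E, Nat.cast_max]
  exact max_le (hD.symm x y ▸ hK x y) (hK y x)

/-! ### The information distance is admissible and a metric up to a constant -/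

/-- A strict upper bound on `D` that is certified by two halting programs and a decidable test can
be found by searching over programs and step bounds. -/
theorem upperSemicomputable_of_programs (hU : IsPrefixMachine U) {D : BStr → BStr → ℝ}
    {r : (BStr × BStr) × (ℕ × ℕ) → BStr × BStr → Bool} (hr : Primrec₂ r)
    (h : ∀ t : (BStr × BStr) × (ℕ × ℕ), D t.1.1 t.1.2 < (t.2.1 : ℝ) / ((t.2.2 : ℝ) + 1) ↔
      ∃ p q, t.1.1 ∈ U p t.1.2 ∧ t.1.2 ∈ U q t.1.1 ∧ r t (p, q) = true) :
    UpperSemicomputable D := by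
  obtain ⟨c, hc⟩ := exists_stage (α := BStr × BStr) (β := BStr) hU.partrec
  have hc' : ∀ p y x, x ∈ U p y ↔ ∃ k, x ∈ stage BStr c k (p, y) := fun p y x => hc (p, y) x
  let R : (BStr × BStr) × (ℕ × ℕ) → ℕ → Bool := fun t n =>
    ((decode (α := (BStr × BStr) × ℕ) n).map fun e =>
      decide (stage BStr c e.2 (e.1.1, t.1.2) = some t.1.1) &&
        (decide (stage BStr c e.2 (e.1.2, t.1.1) = some t.1.2) && r t e.1)).getD false
  have hR : Primrec₂ R := by
    refine Primrec.option_getD.comp (Primrec.option_map (Primrec.decode.comp Primrec.snd) ?_)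
      (Primrec.const false)
    have hx : Primrec fun t : (((BStr × BStr) × (ℕ × ℕ)) × ℕ) × ((BStr × BStr) × ℕ) =>
        t.1.1.1.1 := Primrec.fst.comp (Primrec.fst.comp (Primrec.fst.comp Primrec.fst))
    have hy : Primrec fun t : (((BStr × BStr) × (ℕ × ℕ)) × ℕ) × ((BStr × BStr) × ℕ) =>
        t.1.1.1.2 := Primrec.snd.comp (Primrec.fst.comp (Primrec.fst.comp Primrec.fst))
    have hk : Primrec fun t : (((BStr × BStr) × (ℕ × ℕ)) × ℕ) × ((BStr × BStr) × ℕ) =>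
        (t.2.2, c) := (Primrec.snd.comp Primrec.snd).pair (Primrec.const c)
    refine Primrec.and.comp ?_ (Primrec.and.comp ?_ ?_)
    · exact (Primrec.eq.comp (primrec_stage.comp (hk.pair
        ((Primrec.fst.comp (Primrec.fst.comp Primrec.snd)).pair hy)))
        (Primrec.option_some.comp hx)).decide
    · exact (Primrec.eq.comp (primrec_stage.comp (hk.pair
        ((Primrec.snd.comp (Primrec.fst.comp Primrec.snd)).pair hx)))
        (Primrec.option_some.comp hy)).decide
    · exact hr.comp (Primrec.fst.comp Primrec.fst) (Primrec.fst.comp Primrec.snd)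
  refine rePred_of_exists (r := R) hR.to_comp fun t => (h t).trans ⟨?_, ?_⟩
  · rintro ⟨p, q, hp, hq, hpq⟩
    obtain ⟨k, hk⟩ := (hc' _ _ _).1 hp
    obtain ⟨m, hm⟩ := (hc' _ _ _).1 hq
    refine ⟨encode ((p, q), max k m), ?_⟩
    simp only [R, encodek, Option.map_some, Option.getD_some, Bool.and_eq_true, decide_eq_true_eq]
    exact ⟨stage_mono (le_max_left k m) hk, stage_mono (le_max_right k m) hm, hpq⟩
  · rintro ⟨n, hn⟩
    simp only [R] at hn
    cases hd : (decode n : Option ((BStr × BStr) × ℕ)) with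
    | none => simp [hd] at hn
    | some e =>
      simp only [hd, Option.map_some, Option.getD_some, Bool.and_eq_true,
        decide_eq_true_eq] at hn
      exact ⟨e.1.1, e.1.2, (hc' _ _ _).2 ⟨_, hn.1⟩, (hc' _ _ _).2 ⟨_, hn.2.1⟩, hn.2.2⟩

theorem IsUniversalPrefixMachine.E_add_lt_iff (hU : IsUniversalPrefixMachine U) (c : ℕ)
    (x y : BStr) (a b : ℕ) : E U x y + c < (a : ℝ) / ((b : ℝ) + 1) ↔
      ∃ p q, x ∈ U p y ∧ y ∈ U q x ∧ (max p.length q.length + c) * (b + 1) < a := by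
  have hcast : E U x y + c < (a : ℝ) / ((b : ℝ) + 1) ↔
      (max (K U x y) (K U y x) + c) * (b + 1) < a := by
    rw [lt_div_iff₀ (by positivity), E]
    exact_mod_cast Iff.rfl
  rw [hcast]
  constructor
  · intro h
    obtain ⟨p, hp, hpl⟩ := hU.exists_program_length_eq_K x y
    obtain ⟨q, hq, hql⟩ := hU.exists_program_length_eq_K y x
    exact ⟨p, q, hp, hq, by rwa [hpl, hql]⟩
  · rintro ⟨p, q, hp, hq, h⟩
    refine lt_of_le_of_lt ?_ h
    gcongr
    · exact K_le_length hp
    · exact K_le_length hq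

theorem primrec_length_bound (c : ℕ) :
    Primrec₂ fun (t : (BStr × BStr) × (ℕ × ℕ)) (e : BStr × BStr) =>
      decide ((max e.1.length e.2.length + c) * (t.2.2 + 1) < t.2.1) := by
  refine (Primrec.nat_lt.comp (Primrec.nat_mul.comp (Primrec.nat_add.comp
    (Primrec.nat_max.comp ?_ ?_) (Primrec.const c)) ?_) ?_).decide
  · exact Primrec.list_length.comp (Primrec.fst.comp Primrec.snd)
  · exact Primrec.list_length.comp (Primrec.snd.comp Primrec.snd)
  · exact Primrec.succ.comp (Primrec.snd.comp (Primrec.snd.comp Primrec.fst))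
  · exact Primrec.fst.comp (Primrec.snd.comp Primrec.fst)

theorem IsUniversalPrefixMachine.E_upperSemicomputable (hU : IsUniversalPrefixMachine U) :
    UpperSemicomputable (E U) := by
  refine upperSemicomputable_of_programs hU.isPrefixMachine (primrec_length_bound 0) fun t => ?_
  have := hU.E_add_lt_iff 0 t.1.1 t.1.2 t.2.1 t.2.2
  simpa only [Nat.cast_zero, add_zero, decide_eq_true_eq] using this

theorem IsUniversalPrefixMachine.shift_E_upperSemicomputable (hU : IsUniversalPrefixMachine U)
    (c : ℕ) : UpperSemicomputable (shift c (E U)) := by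
  refine upperSemicomputable_of_programs hU.isPrefixMachine
    (r := fun t e => bif decide (t.1.1 = t.1.2) then decide (0 < t.2.1) else
      decide ((max e.1.length e.2.length + c) * (t.2.2 + 1) < t.2.1)) ?_ fun t => ?_
  · refine Primrec.cond ?_ ?_ (primrec_length_bound c)
    · exact (Primrec.eq.comp (Primrec.fst.comp (Primrec.fst.comp Primrec.fst))
        (Primrec.snd.comp (Primrec.fst.comp Primrec.fst))).decide
    · exact (Primrec.nat_lt.comp (Primrec.const 0)
        (Primrec.fst.comp (Primrec.snd.comp Primrec.fst))).decide
  · by_cases h : t.1.1 = t.1.2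
    · obtain ⟨p, hp⟩ := hU.exists_program t.1.1 t.1.2
      obtain ⟨q, hq⟩ := hU.exists_program t.1.2 t.1.1
      have hb : (0 : ℝ) < t.2.2 + 1 := by positivity
      simp only [shift, if_pos h, div_pos_iff_of_pos_right hb, Nat.cast_pos, decide_eq_true h,
        cond_true, decide_eq_true_eq]
      exact ⟨fun h => ⟨p, q, hp, hq, h⟩, fun ⟨_, _, _, _, h⟩ => h⟩
    · simp only [shift, if_neg h, decide_eq_false h, cond_false, decide_eq_true_eq]
      exact hU.E_add_lt_iff c t.1.1 t.1.2 t.2.1 t.2.2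

theorem IsUniversalPrefixMachine.E_isAdmissible (hU : IsUniversalPrefixMachine U) :
    IsAdmissible (E U) where
  nonneg := E_nonneg
  symm := E_symm
  upperSemicomputable := hU.E_upperSemicomputable
  density x := by
    refine (ENNReal.tsum_le_tsum fun y => ENNReal.ofReal_le_ofReal ?_).trans (hU.kraft x)
    rw [one_div, inv_pow, Real.rpow_neg (by norm_num), E, Real.rpow_natCast]
    exact inv_anti₀ (by positivity) (pow_le_pow_right₀ (by norm_num) (le_max_right _ _))

theorem IsUniversalPrefixMachine.exists_E_isMetricUpTo (hU : IsUniversalPrefixMachine U) :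
    ∃ c : ℕ, IsMetricUpTo c (E U) := by
  obtain ⟨c, hc⟩ := hU.exists_K_self_le
  obtain ⟨d, hd⟩ := hU.exists_K_triangle
  refine ⟨c + d, E_nonneg, fun x => ?_, fun x y h => absurd h (hU.E_pos x y).ne', E_symm,
    fun x y z => ?_⟩
  · rw [E, max_self]
    exact_mod_cast (hc x).trans (Nat.le_add_right c d)
  · simp only [E]
    norm_cast
    have h1 := hd x y z
    have h2 := hd y x z
    omega

theorem IsUniversalPrefixMachine.shift_E_isMetric (hU : IsUniversalPrefixMachine U) {c : ℕ}
    (hc : IsMetricUpTo c (E U)) : IsMetric (shift c (E U)) where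
  nonneg x y := by
    unfold shift
    split_ifs
    · exact le_rfl
    · have := E_nonneg (U := U) x y
      positivity
  eq_zero_iff x y := by
    unfold shift
    split_ifs with h
    · simp [h]
    · have := hU.E_pos x y
      simp only [h, iff_false]
      positivity
  symm x y := by simp only [shift, eq_comm (a := x), E_symm x y]
  triangle x y z := by
    -- For three distinct points the right side carries `2 * c` and the left side `c`, which absorbs
    -- the defect of the triangle inequality; if two points coincide, nonnegativity suffices.
    have h0 : (0 : ℝ) ≤ c := c.cast_nonneg
    have hxz := E_nonneg (U := U) x z
    have hzy := E_nonneg (U := U) z y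
    have := hc.triangle x y z
    unfold shift
    split_ifs with h1 h2 h3 h3 h2 h3 h3
    all_goals first
      | linarith
      | (subst_vars; first | exact absurd rfl h1 | linarith)

theorem IsUniversalPrefixMachine.shift_E_isOffDiagAdmissible (hU : IsUniversalPrefixMachine U)
    {c : ℕ} (hc : IsMetric (shift c (E U))) : IsOffDiagAdmissible (shift c (E U)) where
  nonneg := hc.nonneg
  symm := hc.symm
  upperSemicomputable := hU.shift_E_upperSemicomputable c
  density x := by
    refine (ENNReal.tsum_le_tsum fun y => ENNReal.ofReal_le_ofReal ?_).trans
      (hU.E_isAdmissible.isOffDiagAdmissible.density x)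
    refine Real.rpow_le_rpow_of_exponent_le (by norm_num) ?_
    rw [shift, if_neg y.2.symm]
    have : (0 : ℝ) ≤ c := c.cast_nonneg
    linarith

end InfoDist

theorem mainTheorem1 :
    (∃ U : InfoDist.BStr → InfoDist.BStr →. InfoDist.BStr,
      InfoDist.IsUniversalPrefixMachine U) ∧
    ∀ U : InfoDist.BStr → InfoDist.BStr →. InfoDist.BStr, InfoDist.IsUniversalPrefixMachine U →
      -- the minimum that defines `K(x | y)` is over a nonempty set
      (∀ x y : InfoDist.BStr, ∃ p : InfoDist.BStr, x ∈ U p y) ∧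
      -- admissibility
      InfoDist.IsAdmissible (InfoDist.E U) ∧
      -- metric up to an additive constant, and an exact metric after an additive correction
      (∃ c : ℕ, InfoDist.IsMetricUpTo c (InfoDist.E U) ∧
        InfoDist.IsMetric (InfoDist.shift c (InfoDist.E U)) ∧
        InfoDist.IsOffDiagAdmissible (InfoDist.shift c (InfoDist.E U))) ∧
      -- minimality
      (∀ D : InfoDist.BStr → InfoDist.BStr → ℝ, InfoDist.IsOffDiagAdmissible D →
        ∃ c : ℝ, ∀ x y : InfoDist.BStr, InfoDist.E U x y ≤ D x y + c) := by
  refine ⟨⟨_, InfoDist.isUniversalPrefixMachine_universalMachine⟩, fun U hU =>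
    ⟨hU.exists_program, hU.E_isAdmissible, ?_, fun D hD => hU.exists_E_le hD⟩⟩
  obtain ⟨c, hc⟩ := hU.exists_E_isMetricUpTo
  have hm := hU.shift_E_isMetric hc
  exact ⟨c, hc, hm, hU.shift_E_isOffDiagAdmissible hm⟩
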